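/- Let $T$ be a complete first-order theory in a language $L$, and let $\bar M$ be a sufficiently saturated model of $T$ ($\aleph_1$-saturated suffices; this holds in any monster model). Assume that $T$ is strongly dependent: there do not exist $L$-formulas $\varphi^\alpha(x,y^\alpha)$ ($\alpha<\omega$), with $x$ and $y^\alpha$ finite tuples of variables, and tuples $b^\alpha_i$ ($\alpha,i<\omega$) in a model of $T$ such that for every $\eta\in\omega^\omega$ the set of formulas $$\{\varphi^\alpha(x,b^\alpha_{\eta(\alpha)}):\alpha<\omega\}\cup\{\neg\varphi^\alpha(x,b^\alpha_i):\alpha,i<\omega,\ i\neq\eta(\alpha)\}$$ is consistent. Let $I=(a_i:i\in[0,1])$ be an indiscernible segment in $\bar M$, i.e. a family of finite tuples of a fixed length that is indiscernible over $\emptyset$ with respect to the usual ordering of $[0,1]$. For a formula $\psi(x)$ with parameters in $\bar M$, let $\mu_I(\psi(x))$ be the Lebesgue measure of $\{i\in[0,1]:\bar M\models\psi(a_i)\}$. Let $\varphi(x,y)$ be a formula with parameters in $\bar M$, where $x,y$ are finite tuples of variables and $x$ has the length of the $a_i$, such that $\mu_I(\varphi(x,b))=0$ for every tuple $b$ of $\bar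 M$ of the length of $y$. Then there is $k<\omega$ such that $\{\varphi(a_i,y):i\in[0,1]\}$ is $k$-inconsistent, i.e. for any $k$ distinct indices $i_1,\dots,i_k\in[0,1]$ the set $\{\varphi(a_{i_1},y),\dots,\varphi(a_{i_k},y)\}$ is inconsistent. -/

import Mathlib

open FirstOrder Cardinal MeasureTheory

universe u v w u' v'

namespace FirstOrder.Language

section Consistency

variable {L : Language.{u', v'}} (M : Type w) [L.Structure M] {β : Type*}

/-- A set of formulas (possibly with parameters, if `L` names elements of `M`) is consistent,
relative to the structure `M`, if every finite subset of it is realized in `M`. -/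
def IsConsistentIn (Γ : Set (L.Formula β)) : Prop :=
  ∀ F : Finset (L.Formula β), (F : Set (L.Formula β)) ⊆ Γ →
    ∃ v : β → M, ∀ ψ ∈ F, ψ.Realize v

/-- A family of formulas is `k`-inconsistent if any `k` members of it (with distinct indices) are
jointly inconsistent. -/
def IsKInconsistentIn {ι : Type*} (k : ℕ) (ψ : ι → L.Formula β) : Prop :=
  ∀ S : Finset ι, S.card = k → ¬ IsConsistentIn M (ψ '' (S : Set ι))

end Consistency

variable {L : Language.{u, v}} {M : Type w}

/-- The formula `φ(x, b)` over `M`, for a formula `φ(x, y)` over `M` and a tuple `b` of `M`. -/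
def Formula.instRight {β γ : Type*} (φ : L[[M]].Formula (β ⊕ γ)) (b : γ → M) :
    L[[M]].Formula β :=
  BoundedFormula.subst φ (Sum.elim Term.var fun j => (L.con (b j)).term)

/-- The formula `φ(a, y)` over `M`, for a formula `φ(x, y)` over `M` and a tuple `a` of `M`. -/
def Formula.instLeft {β γ : Type*} (φ : L[[M]].Formula (β ⊕ γ)) (a : β → M) :
    L[[M]].Formula γ :=
  BoundedFormula.subst φ (Sum.elim (fun i => (L.con (a i)).term) Term.var)

/-- The complete theory `T` is strongly dependent: in models of `T` there are no formulas
`φ α (x, y_α)` of `L`, for `α < ω`, and tuples `b α i`, for `α, i < ω`, such that for every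
`η : ω → ω` the set of all `φ α (x, b α (η α))` and of all `¬ φ α (x, b α i)` with `i ≠ η α` is
consistent. The models range over the universe `w`; for a complete theory that has a sufficiently
saturated model in that universe, this is the same as having no such array in that model. -/
def Theory.IsStronglyDependent (T : L.Theory) : Prop :=
  ∀ (N : Type w) [L.Structure N] [Nonempty N] [N ⊨ T],
    ¬ ∃ (n : ℕ) (m : ℕ → ℕ) (φ : ∀ α, L.Formula (Fin n ⊕ Fin (m α)))
        (b : ∀ α : ℕ, ℕ → Fin (m α) → N), ∀ η : ℕ → ℕ,
      IsConsistentIn N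
        ({ψ : L[[N]].Formula (Fin n) | ∃ α : ℕ,
            ψ = Formula.instRight ((L.lhomWithConstants N).onFormula (φ α)) (b α (η α))} ∪
         {ψ : L[[N]].Formula (Fin n) | ∃ α i : ℕ, i ≠ η α ∧
            ψ = ∼(Formula.instRight ((L.lhomWithConstants N).onFormula (φ α)) (b α i))})

variable (L M) in
/-- `M` is `κ`-saturated: every consistent set of formulas in finitely many variables over a set
of fewer than `κ` parameters is realized in `M`. -/
def IsSaturated [L.Structure M] (κ : Cardinal.{w}) : Prop :=
  ∀ A : Set M, #A < κ → ∀ (n : ℕ) (p : Set (L[[A]].Formula (Fin n))),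
    IsConsistentIn M p → ∃ v : Fin n → M, ∀ ψ ∈ p, ψ.Realize v

variable (L) in
/-- The family `a` of `n`-tuples, indexed by a linear order, is indiscernible (over `∅`). -/
def IsIndiscernible [L.Structure M] {ι : Type*} [LinearOrder ι] {n : ℕ}
    (a : ι → Fin n → M) : Prop :=
  ∀ (k : ℕ) (ψ : L.Formula (Fin k × Fin n)) (s t : Fin k → ι), StrictMono s → StrictMono t →
    (ψ.Realize (fun p => a (s p.1) p.2) ↔ ψ.Realize (fun p => a (t p.1) p.2))

/-- The average measure `μ_I` of a segment `I = (a i : i ∈ [0,1])`: a formula `ψ(x)` over `M` gets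
the Lebesgue measure of the set of all `i ∈ [0,1]` with `M ⊨ ψ(a i)`. (If `I` is indiscernible and
the theory of `M` is dependent, this set is a finite union of intervals and points.) -/
noncomputable def averageMeasure [L.Structure M] {n : ℕ} (a : Set.Icc (0 : ℝ) 1 → Fin n → M)
    (ψ : L[[M]].Formula (Fin n)) : ENNReal :=
  volume {i : Set.Icc (0 : ℝ) 1 | ψ.Realize (a i)}

end FirstOrder.Language

/-!
The theorem reduces to the fact that no formula has the independence property in `T`, which is the
instance of strong dependence in which all the rows of the array use the same formula.

Write `φ(x, y)` as `θ(x, y, c)` with `θ` over `∅` and `c` a finite tuple. Suppose that for every `k`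
some `b` satisfies `φ(a i, b)` at `k + 1` distinct indices `i`. As `μ_I(φ(x, b)) = 0` and nontrivial
intervals have positive measure, `φ(a i, b)` fails somewhere between any two of these indices, so
the truth value of `θ(a i, b, c)` alternates along `I`, and every pattern of `k` truth values occurs
along some increasing `k`-tuple of indices (`exists_strictMono_pattern`). That a pattern is realized
by some tuple is expressed by an existential `L`-formula, so by indiscernibility it is realized at
*every* increasing `k`-tuple of indices (`IsIndiscernible.exists_pattern`): the instances of `θ`
pick out all subsets of every finite part of `I`. Arranging infinitely many of the `a i` in an
`ω × ω` array then contradicts strong dependence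
(`Theory.IsStronglyDependent.exists_not_pattern`).
-/

namespace FirstOrder.Language

/-! ### Instances of formulas and their parameters -/

section Instances

variable {L : Language.{u, v}} {M : Type w} [L.Structure M] {β γ : Type*}

theorem coe_con_self (c : M) : ((L.con c : L[[M]].Constants) : M) = c := rfl

theorem Formula.realize_instRight (φ : L[[M]].Formula (β ⊕ γ)) (b : γ → M) (x : β → M) :
    (φ.instRight b).Realize x ↔ φ.Realize (Sum.elim x b) := by
  unfold Formula.instRight Formula.Realize
  rw [BoundedFormula.realize_subst]
  congr! 1
  ext (i | j)
  · rfl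
  · simp [Term.realize_constants, coe_con_self]

theorem Formula.realize_instLeft (φ : L[[M]].Formula (β ⊕ γ)) (a : β → M) (y : γ → M) :
    (φ.instLeft a).Realize y ↔ φ.Realize (Sum.elim a y) := by
  unfold Formula.instLeft Formula.Realize
  rw [BoundedFormula.realize_subst]
  congr! 1
  ext (i | j)
  · simp [Term.realize_constants, coe_con_self]
  · rfl

/-- A formula `φ(x, y)` with parameters is `θ(x, e y)` for a parameter-free `θ`, where the tuple
`e y` consists of `y` and of the finitely many parameters of `φ`. -/
theorem Formula.exists_fin_parameters {m : ℕ} (φ : L[[M]].Formula (β ⊕ Fin m)) :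
    ∃ (r : ℕ) (θ : L.Formula (β ⊕ Fin r)) (e : (Fin m → M) → Fin r → M),
      ∀ x y, φ.Realize (Sum.elim x y) ↔ θ.Realize (Sum.elim x (e y)) := by
  classical
  set φ' : L.BoundedFormula (M ⊕ (β ⊕ Fin m)) 0 := BoundedFormula.constantsVarsEquiv φ with hφ'
  let A : Finset M := φ'.freeVarFinset.toLeft
  let E : A ⊕ Fin m ≃ Fin (Fintype.card (A ⊕ Fin m)) := Fintype.equivFin _
  let f : φ'.freeVarFinset → β ⊕ Fin (Fintype.card (A ⊕ Fin m)) := fun z =>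
    match z with
    | ⟨Sum.inl c, h⟩ => Sum.inr (E (Sum.inl ⟨c, Finset.mem_toLeft.2 h⟩))
    | ⟨Sum.inr (Sum.inl i), _⟩ => Sum.inl i
    | ⟨Sum.inr (Sum.inr j), _⟩ => Sum.inr (E (Sum.inr j))
  refine ⟨_, φ'.restrictFreeVar f, fun y => Sum.elim (fun c : A => (c : M)) y ∘ E.symm,
    fun x y => ?_⟩
  unfold Formula.Realize
  rw [BoundedFormula.realize_restrictFreeVar
    (Sum.elim (fun c : M => ((L.con c : L[[M]].Constants) : M)) (Sum.elim x y)), hφ',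
    BoundedFormula.realize_constantsVarsEquiv]
  rintro ⟨c | i | j, h⟩
  · simp [f, coe_con_self]
  · simp [f]
  · simp [f]

end Instances

/-! ### Patterns of truth values along a linear order -/

/-- If `p` holds at `k + 1` points and fails somewhere in every open interval, then every pattern of
`k` truth values is the pattern of `p` along some increasing `k`-tuple. -/
theorem exists_strictMono_pattern {ι : Type*} [LinearOrder ι] {p : ι → Prop} {k : ℕ}
    {s : Fin (k + 1) → ι} (hs : StrictMono s) (hp : ∀ j, p (s j))
    (hgap : ∀ i j, i < j → ∃ l ∈ Set.Ioo i j, ¬ p l) (Q : Fin k → Prop) :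
    ∃ t : Fin k → ι, StrictMono t ∧ ∀ j, p (t j) ↔ Q j := by
  have h : ∀ j : Fin k, ∃ x ∈ Set.Ico (s j.castSucc) (s j.succ), p x ↔ Q j := by
    intro j
    have hlt : s j.castSucc < s j.succ := hs j.castSucc_lt_succ
    by_cases hQ : Q j
    · exact ⟨_, ⟨le_rfl, hlt⟩, iff_of_true (hp _) hQ⟩
    · obtain ⟨l, hl, hpl⟩ := hgap _ _ hlt
      exact ⟨l, ⟨hl.1.le, hl.2⟩, iff_of_false hpl hQ⟩
  choose t ht htQ using h
  refine ⟨t, fun i j hij => ?_, htQ⟩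
  exact ((ht i).2.trans_le (hs.monotone (Fin.succ_le_castSucc_iff.2 hij))).trans_le (ht j).1

section Patterns

variable {L : Language.{u, v}} {M : Type w} [L.Structure M]

/-- If a pattern of truth values of `θ(·, c)` occurs along some increasing tuple of indices of an
indiscernible family, then it occurs along every increasing tuple, for a suitable `c'`. -/
theorem IsIndiscernible.exists_pattern {ι : Type*} [LinearOrder ι] {n r k : ℕ}
    {a : ι → Fin n → M} (ha : IsIndiscernible L a) (θ : L.Formula (Fin n ⊕ Fin r))
    {s t : Fin k → ι} (hs : StrictMono s) (ht : StrictMono t) (Q : Fin k → Prop) {c : Fin r → M}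
    (hc : ∀ j, θ.Realize (Sum.elim (a (s j)) c) ↔ Q j) :
    ∃ c' : Fin r → M, ∀ j, θ.Realize (Sum.elim (a (t j)) c') ↔ Q j := by
  classical
  let χ : Fin k → L.Formula ((Fin k × Fin n) ⊕ Fin r) := fun j =>
    θ.relabel (Sum.map (Prod.mk j) id)
  let ψ : L.Formula (Fin k × Fin n) :=
    (Formula.iInf fun j => if Q j then χ j else ∼(χ j)).iExs (Fin r)
  have hψ : ∀ u : Fin k → ι, ψ.Realize (fun p => a (u p.1) p.2) ↔
      ∃ c : Fin r → M, ∀ j, θ.Realize (Sum.elim (a (u j)) c) ↔ Q j := by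
    intro u
    simp only [ψ, Formula.realize_iExs, Formula.realize_iInf]
    refine exists_congr fun c => forall_congr' fun j => ?_
    have hχ : (χ j).Realize (Sum.elim (fun p : Fin k × Fin n => a (u p.1) p.2) c) ↔
        θ.Realize (Sum.elim (a (u j)) c) := by
      simp only [χ, Formula.realize_relabel]
      congr! 1
      ext (i | i) <;> rfl
    by_cases hQ : Q j
    · simp [hQ, hχ]
    · simp [hQ, hχ, Formula.realize_not]
  exact (hψ t).1 ((ha k ψ s t hs ht).1 ((hψ s).2 ⟨c, hc⟩))

/-- In a strongly dependent theory no formula realizes all patterns of truth values on the finite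
parts of an infinite family: otherwise an array with the same formula in every row would contradict
strong dependence. -/
theorem Theory.IsStronglyDependent.exists_not_pattern {T : L.Theory}
    (hsd : Theory.IsStronglyDependent.{u, v, w} T) [Nonempty M] [M ⊨ T] {ι : Type*} [Infinite ι]
    {n r : ℕ} (a : ι → Fin n → M) (θ : L.Formula (Fin n ⊕ Fin r)) :
    ∃ (P : Finset ι) (Q : ι → Prop),
      ¬ ∃ c : Fin r → M, ∀ i ∈ P, θ.Realize (Sum.elim (a i) c) ↔ Q i := by
  classical
  by_contra! hθ
  obtain ⟨d⟩ : Nonempty (ℕ × ℕ ↪ ι) :=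
    ⟨(Denumerable.eqv (ℕ × ℕ)).toEmbedding.trans (Infinite.natEmbedding ι)⟩
  -- In the array the roles of the variables are exchanged: the `a i` are the parameters.
  refine hsd M ⟨r, fun _ => n, fun _ => θ.relabel Sum.swap, fun α i => a (d (α, i)),
    fun η F hF => ?_⟩
  have hreal : ∀ (x : Fin r → M) (i : ι),
      (((L.lhomWithConstants M).onFormula (θ.relabel Sum.swap)).instRight (a i)).Realize x ↔
        θ.Realize (Sum.elim (a i) x) := by
    intro x i
    rw [Formula.realize_instRight, LHom.realize_onFormula, Formula.realize_relabel]
    congr! 1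
    ext (i | i) <;> rfl
  have hQ : ∀ ψ ∈ F, ∃ q : ℕ × ℕ, ∀ x : Fin r → M,
      (θ.Realize (Sum.elim (a (d q)) x) ↔ q.2 = η q.1) → ψ.Realize x := by
    intro ψ hψ
    rcases hF hψ with ⟨α, rfl⟩ | ⟨α, i, hi, rfl⟩
    · exact ⟨(α, η α), fun x hx => (hreal x _).2 (hx.2 rfl)⟩
    · refine ⟨(α, i), fun x hx => ?_⟩
      rw [Formula.realize_not, hreal]
      exact fun h => hi (hx.1 h)
  choose! q hq using hQ
  obtain ⟨x, hx⟩ := hθ (F.image fun ψ => d (q ψ)) fun i => ∃ z : ℕ × ℕ, d z = i ∧ z.2 = η z.1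
  refine ⟨x, fun ψ hψ => hq ψ hψ x ?_⟩
  rw [hx _ (Finset.mem_image_of_mem _ hψ)]
  exact ⟨fun ⟨z, hz, h⟩ => d.injective hz ▸ h, fun h => ⟨_, rfl, h⟩⟩

end Patterns

/-! ### Null sets in the unit interval -/

/-- The complement of a null set of `[0,1]` meets every nonempty open interval. -/
theorem exists_mem_Ioo_not_of_volume_eq_zero {p : Set.Icc (0 : ℝ) 1 → Prop}
    (hp : volume {i | p i} = 0) {i j : Set.Icc (0 : ℝ) 1} (hij : i < j) :
    ∃ l ∈ Set.Ioo i j, ¬ p l := by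
  by_contra! h
  have h0 : volume (Set.Ioo i j) = 0 := measure_mono_null (fun l hl => h l hl) hp
  have h1 := unitInterval.volume_Ioo i j
  rw [h0, eq_comm, ENNReal.ofReal_eq_zero, sub_nonpos] at h1
  exact absurd hij (not_lt.2 h1)

end FirstOrder.Language

open FirstOrder.Language in
theorem lemma3p4 {L : FirstOrder.Language.{u, v}} (T : L.Theory) (hT : T.IsComplete)
    (hsd : FirstOrder.Language.Theory.IsStronglyDependent.{u, v, w} T)
    (M : Type w) [L.Structure M] [Nonempty M] [M ⊨ T]
    (κ : Cardinal.{w}) (hκ : ℵ₀ < κ) (hM : FirstOrder.Language.IsSaturated L M κ)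
    {n m : ℕ} (a : Set.Icc (0 : ℝ) 1 → Fin n → M) (ha : FirstOrder.Language.IsIndiscernible L a)
    (φ : L[[M]].Formula (Fin n ⊕ Fin m))
    (hφ : ∀ b : Fin m → M, FirstOrder.Language.averageMeasure a (φ.instRight b) = 0) :
    ∃ k : ℕ, FirstOrder.Language.IsKInconsistentIn M k (fun i : Set.Icc (0 : ℝ) 1 => φ.instLeft (a i)) := by
  classical
  obtain ⟨r, θ, e, hθ⟩ := φ.exists_fin_parameters
  have : Infinite (Set.Icc (0 : ℝ) 1) := (Set.Icc_infinite zero_lt_one).to_subtype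
  obtain ⟨P, Q, hPQ⟩ := hsd.exists_not_pattern a θ
  -- One point more than the pattern has: its entries are read off in the gaps.
  refine ⟨P.card + 1, fun S hS hcons => hPQ ?_⟩
  obtain ⟨b, hb⟩ := hcons (S.image fun i => φ.instLeft (a i)) (by simp)
  have hb' : ∀ i ∈ S, φ.Realize (Sum.elim (a i) b) := fun i hi =>
    (Formula.realize_instLeft φ (a i) b).1 (hb _ (Finset.mem_image_of_mem _ hi))
  have hnull : volume {i | φ.Realize (Sum.elim (a i) b)} = 0 := by
    simpa only [averageMeasure, Formula.realize_instRight] using hφ b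
  obtain ⟨t, ht, htQ⟩ := exists_strictMono_pattern
    (p := fun i => φ.Realize (Sum.elim (a i) b)) (S.orderEmbOfFin hS).strictMono
    (fun j => hb' _ (S.orderEmbOfFin_mem hS j))
    (fun i j hij => exists_mem_Ioo_not_of_volume_eq_zero hnull hij)
    (fun j => Q (P.orderEmbOfFin rfl j))
  obtain ⟨c, hc⟩ := ha.exists_pattern θ ht (P.orderEmbOfFin rfl).strictMono _
    fun j => (hθ _ _).symm.trans (htQ j)
  refine ⟨c, fun i hi => ?_⟩
  obtain ⟨j, rfl⟩ : i ∈ Set.range (P.orderEmbOfFin rfl) := by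
    rwa [Finset.range_orderEmbOfFin]
  exact hc j
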